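/- Let $M_0,M\ge 1$, and let $T$ be a transition matrix of GI/G/1 type on the state space $(\{0\}\times\{1,\dots,M_0\})\cup(\{1,2,\dots\}\times\{1,\dots,M\})$: with respect to the levels $0,1,2,\dots$ it has the blocks $T_{0,0}=B(0)$, $T_{0,l}=B(l)$, $T_{k,0}=B(-k)$ and $T_{k,l}=A(l-k)$ for $k,l\ge 1$. Assume that $T$ is stochastic, irreducible and positive recurrent, with stationary distribution $x=(x(0),x(1),x(2),\dots)$, and that $A=\sum_{k\in\mathbb Z}A(k)$ is irreducible and strictly substochastic, i.e. $Ae\le e$ and $Ae\ne e$ for the column vector $e$ of ones. For $k\ge 0$ put $\overline{x}(k)=\sum_{l>k}x(l)$, $\overline{A}(k)=\sum_{l>k}A(l)$ and $\overline{B}(k)=\sum_{l>k}B(l)$. Let $Y$ be a random variable with values in $\{0,1,2,\dots\}$ and suppose that $$\lim_{k\to\infty}\frac{\overline{A}(k)}{\mathsf P(Y>k)}=C_A,\qquad \lim_{k\to\infty}\frac{\overline{B}(k)}{\mathsf P(Y>k)}=C_B,$$ where $C_A$ and $C_B$ are nonnegative $M\times M$ and $M_0\times M$ matrices, not both zero.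 Suppose that $Y$ is subexponential: $\mathsf P(Y>k)>0$ for all $k\ge 0$ and $\lim_{k\to\infty}\mathsf P(Y_1+Y_2>k)/\mathsf P(Y>k)=2$ for independent copies $Y_1,Y_2$ of $Y$. Then $I-A$ is invertible and $$\lim_{k\to\infty}\frac{\overline{x}(k)}{\mathsf P(Y>k)}=\bigl[x(0)C_B+\overline{x}(0)C_A\bigr](I-A)^{-1}>0,$$ where the inequality holds in every component. -/

import Mathlib

open MeasureTheory Filter Topology
open scoped ENNReal Matrix

namespace GIG1

/-! ### Markov chains on an arbitrary (countable) state space -/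

section Chain

variable {S : Type*}

/-- A (possibly infinite) matrix is stochastic: nonnegative entries and all rows sum to one. -/
def IsStochastic (T : Matrix S S ℝ) : Prop :=
  (∀ s t, 0 ≤ T s t) ∧ ∀ s, HasSum (fun t => T s t) 1

/-- `firstPassage T n s t` is the probability that the chain with transition matrix `T`, started
in `s`, visits `t` at time `n` for the first time among the times `1, 2, 3, …`. -/
noncomputable def firstPassage (T : Matrix S S ℝ) : ℕ → S → S → ℝ≥0∞
  | 0, _, _ => 0
  | 1, s, t => ENNReal.ofReal (T s t)
  | n + 2, s, t => ∑' u : {u : S // u ≠ t}, ENNReal.ofReal (T s u) * firstPassage T (n + 1) u t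

/-- Positive recurrence: from every state the chain returns to that state with probability one,
and the mean return time is finite. -/
def IsPositiveRecurrent (T : Matrix S S ℝ) : Prop :=
  ∀ s, ∑' n : ℕ, firstPassage T n s s = 1 ∧ ∑' n : ℕ, (n : ℝ≥0∞) * firstPassage T n s s < ∞

/-- `x` is a stationary distribution of `T`: a probability vector with `x T = x`. -/
def IsStationaryDistribution (T : Matrix S S ℝ) (x : S → ℝ) : Prop :=
  (∀ s, 0 ≤ x s) ∧ HasSum x 1 ∧ ∀ t, HasSum (fun s => x s * T s t) (x t)

end Chain

/-- A finite square matrix `Q` is strictly substochastic: it is nonnegative, `Q e ≤ e` and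
`Q e ≠ e`, with `e` the vector of ones. -/
def IsStrictlySubstochastic {M : ℕ} (Q : Matrix (Fin M) (Fin M) ℝ) : Prop :=
  (∀ i j, 0 ≤ Q i j) ∧ Q *ᵥ 1 ≤ 1 ∧ Q *ᵥ 1 ≠ 1

/-! ### GI/G/1-type Markov chains -/

/-- The state space: `Sum.inl j` is the state `(0, j)` of level `0`, and `Sum.inr (k, j)` is the
state `(k, j)` of level `k ≥ 1`. -/
abbrev State (M₀ M : ℕ) : Type := Fin M₀ ⊕ (ℕ+ × Fin M)

/-- The blocks of a transition matrix of GI/G/1 type: `A k` for `k ∈ ℤ`, `B(0) = B₀`,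
`B(k) = Bpos k` and `B(-k) = Bneg k` for `k ≥ 1`. -/
structure Blocks (M₀ M : ℕ) where
  A : ℤ → Matrix (Fin M) (Fin M) ℝ
  B₀ : Matrix (Fin M₀) (Fin M₀) ℝ
  Bpos : ℕ+ → Matrix (Fin M₀) (Fin M) ℝ
  Bneg : ℕ+ → Matrix (Fin M) (Fin M₀) ℝ

namespace Blocks

variable {M₀ M : ℕ} (D : Blocks M₀ M)

/-- The matrix `T` with the given blocks: `B(0)` on level `0`, `B(l)` from level `0` to level `l`,
`B(-k)` from level `k` to level `0`, and `A(l - k)` from level `k` to level `l`. -/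
def T : Matrix (State M₀ M) (State M₀ M) ℝ
  | Sum.inl i, Sum.inl j => D.B₀ i j
  | Sum.inl i, Sum.inr (l, j) => D.Bpos l i j
  | Sum.inr (k, i), Sum.inl j => D.Bneg k i j
  | Sum.inr (k, i), Sum.inr (l, j) => D.A ((l : ℤ) - (k : ℤ)) i j

/-- `A = ∑_{k ∈ ℤ} A(k)`, entrywise. -/
noncomputable def Asum : Matrix (Fin M) (Fin M) ℝ :=
  Matrix.of fun i j => ∑' k : ℤ, D.A k i j

/-- The tail `∑_{l ≥ k + 1} A(l)`, entrywise. -/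
noncomputable def Atail (k : ℕ) : Matrix (Fin M) (Fin M) ℝ :=
  Matrix.of fun i j => ∑' n : ℕ, D.A ((k : ℤ) + (n : ℤ) + 1) i j

/-- The tail `∑_{l ≥ k + 1} B(l)`, entrywise (`(k + n).succPNat` is `k + n + 1`). -/
noncomputable def Btail (k : ℕ) : Matrix (Fin M₀) (Fin M) ℝ :=
  Matrix.of fun i j => ∑' n : ℕ, D.Bpos (k + n).succPNat i j

end Blocks

/-- The part `x(0)` of a vector on the state space that belongs to level `0`. -/
def levelZero {M₀ M : ℕ} (x : State M₀ M → ℝ) : Fin M₀ → ℝ := fun j => x (Sum.inl j)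

/-- The tail `∑_{l ≥ k + 1} x(l)` of a vector on the state space
(`(k + n).succPNat` is `k + n + 1`). -/
noncomputable def levelTail {M₀ M : ℕ} (x : State M₀ M → ℝ) (k : ℕ) : Fin M → ℝ :=
  fun j => ∑' n : ℕ, x (Sum.inr ((k + n).succPNat, j))

/-! ### Subexponential distributions on the nonnegative integers -/

/-- The distribution `μ` on the nonnegative integers is subexponential: its tail never vanishes,
and `P(U₁ + U₂ > k) / P(U > k) → 2` for independent `U₁`, `U₂`, `U` with law `μ` (so that
the pair `(U₁, U₂)` has law `μ.prod μ`). -/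
def IsSubexponential (μ : Measure ℕ) : Prop :=
  (∀ k : ℕ, 0 < μ.real {n | k < n}) ∧
    Tendsto (fun k : ℕ => (μ.prod μ).real {p | k < p.1 + p.2} / μ.real {n | k < n})
      atTop (𝓝 2)

end GIG1

/-! The principle of a single big jump, applied to a matrix renewal equation. Let `h k` be the tail
of the stationary distribution above level `k` and `F` the tail of `Y`. Summing the stationary
equations over the levels above `k` (`levelTail_eq`) writes `h k` as a contribution from level 0,
asymptotic to `x(0) C_B F k`, plus a convolution of the level masses with the tails of the kernel
`A(·)`.

With `k = K + N`, cut the convolution at level index `K`. Indices `m < K` need an upward jump longer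
than `N`; they contribute about `h 0 C_A F k` (`exists_abs_sum_mul_sub_le`), provided that `h ≤ G F`
is already known. The remaining indices contribute at most `h K A` and at least about `h (K + 2N)
A`. Since `F` is long-tailed (`tendsto_div_add`), shifts by `N` or `2N` do not matter after division
by `F`. With `v = x(0) C_B + h 0 C_A`, the componentwise limsup `u` and liminf `l` of `h / F`
therefore satisfy `u ≤ v + u A` and `l ≥ v + l A`. As `(I - A)⁻¹` is nonnegative, `u ≤ l`, and the
limit solves `u (I - A) = v`.

Two facts carry this argument: the a priori bound `exists_h_le`, a strong induction weighted by a
vector that `A` strictly contracts, and the minimum principle `nonneg_of_mulVec_le`, which makes `I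
- A` invertible with a positive inverse (`inv_pos`). Strict positivity of that inverse and of `x`
yields the positivity of the limit. -/

namespace GIG1

/-! ### Tails and subexponential sequences -/

section Tails

/-- `F` is the tail `F k = ∑_{l > k} f l` of the probability mass function `f` on `ℕ`, and this
tail is subexponential. -/
structure SubexpTail (F f : ℕ → ℝ) : Prop where
  pos : ∀ k, 0 < F k
  zero : f 0 = 1 - F 0
  succ : ∀ k, f (k + 1) = F k - F (k + 1)
  nonneg : ∀ k, 0 ≤ f k
  tendsto_zero : Tendsto F atTop (𝓝 0)
  conv : Tendsto (fun k => (∑ l ∈ Finset.range (k + 1), f l * F (k - l)) / F k) atTop (𝓝 1)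

variable {F f : ℕ → ℝ}

theorem SubexpTail.antitone (h : SubexpTail F f) : Antitone F :=
  antitone_nat_of_succ_le fun k => by linarith [h.succ k, h.nonneg (k + 1)]

theorem SubexpTail.sum_range (h : SubexpTail F f) (N : ℕ) :
    ∑ l ∈ Finset.range (N + 1), f l = 1 - F N := by
  induction N with
  | zero => simp [h.zero]
  | succ n ih => rw [Finset.sum_range_succ, ih, h.succ]; ring

theorem SubexpTail.sum_Ioc (h : SubexpTail F f) {a b : ℕ} (hab : a ≤ b) :
    ∑ l ∈ Finset.Ioc a b, f l = F a - F b := by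
  induction b, hab using Nat.le_induction with
  | base => simp
  | succ n hn ih => rw [Finset.sum_Ioc_succ_top (by omega), ih, h.succ]; ring

/-- In the convolution sum at `k + 1`, the terms with `l ≥ 1` have `F (k + 1 - l) ≥ F k` and total
weight `F 0 - F (k + 1)`. Solving for `F k / F (k + 1)` gives an upper bound that tends to `(1 - f
0) / F 0 = 1`. -/
theorem SubexpTail.tendsto_div_succ (h : SubexpTail F f) :
    Tendsto (fun k => F k / F (k + 1)) atTop (𝓝 1) := by
  have h0 := h.pos 0
  have hden : Tendsto (fun k => F 0 - F (k + 1)) atTop (𝓝 (F 0)) := by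
    simpa using tendsto_const_nhds.sub ((tendsto_add_atTop_iff_nat 1).2 h.tendsto_zero)
  have hup : Tendsto (fun k => ((∑ l ∈ Finset.range (k + 1 + 1), f l * F (k + 1 - l)) / F (k + 1)
      - f 0) / (F 0 - F (k + 1))) atTop (𝓝 1) := by
    have := (((tendsto_add_atTop_iff_nat 1).2 h.conv).sub_const (f 0)).div hden h0.ne'
    rwa [h.zero, sub_sub_cancel, div_self h0.ne', ← h.zero] at this
  refine tendsto_of_tendsto_of_tendsto_of_le_of_le' tendsto_const_nhds hup
    (Eventually.of_forall fun k => ?_) ?_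
  · exact (one_le_div (h.pos _)).2 (h.antitone (Nat.le_succ k))
  · filter_upwards [hden.eventually (lt_mem_nhds h0)] with k hk
    rw [le_div_iff₀ hk, le_sub_iff_add_le, le_div_iff₀ (h.pos _), add_mul, mul_right_comm,
      div_mul_cancel₀ _ (h.pos _).ne', ← h.sum_Ioc (Nat.zero_le (k + 1)), Finset.range_eq_Ico,
      Finset.sum_eq_sum_Ico_succ_bot (by omega), Finset.mul_sum, add_comm]
    simp only [Nat.sub_zero, zero_add]
    refine add_le_add le_rfl ?_
    have : Finset.Ioc 0 (k + 1) = Finset.Ico 1 (k + 1 + 1) := by ext; simp; omega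
    rw [this]
    refine Finset.sum_le_sum fun l hl => ?_
    rw [Finset.mem_Ico] at hl
    rw [mul_comm]
    exact mul_le_mul_of_nonneg_left (h.antitone (by omega)) (h.nonneg _)

/-- A subexponential tail is long-tailed. -/
theorem SubexpTail.tendsto_div_add (h : SubexpTail F f) (N : ℕ) :
    Tendsto (fun k => F k / F (k + N)) atTop (𝓝 1) := by
  induction N with
  | zero => simp [div_self (h.pos _).ne']
  | succ n ih =>
    have := ih.mul ((tendsto_add_atTop_iff_nat n).2 h.tendsto_div_succ)
    rw [mul_one] at this
    refine this.congr fun k => ?_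
    rw [div_mul_div_cancel₀ (h.pos _).ne', add_assoc]

/-- The terms `l ≤ N` alone already account for `(1 - F N) F k` of a total asymptotic to `F k`, so
little is left for the others. -/
theorem SubexpTail.exists_sum_Ioc_le (h : SubexpTail F f) {ε : ℝ} (hε : 0 < ε) :
    ∃ N₀, ∀ N ≥ N₀, ∀ᶠ k in atTop, ∑ l ∈ Finset.Ioc N k, f l * F (k - l) ≤ ε * F k := by
  obtain ⟨N₀, hN₀⟩ := eventually_atTop.1 (h.tendsto_zero.eventually (gt_mem_nhds (half_pos hε)))
  refine ⟨N₀, fun N hN => ?_⟩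
  filter_upwards [h.conv.eventually (gt_mem_nhds (show (1 : ℝ) < 1 + ε / 2 by linarith)),
    eventually_ge_atTop N] with k hk hNk
  rw [div_lt_iff₀ (h.pos k)] at hk
  have hsplit : ∑ l ∈ Finset.range (k + 1), f l * F (k - l)
      = ∑ l ∈ Finset.range (N + 1), f l * F (k - l) + ∑ l ∈ Finset.Ioc N k, f l * F (k - l) := by
    rw [← Finset.sum_range_add_sum_Ico _ (show N + 1 ≤ k + 1 by omega)]
    congr 2
    ext; simp
  have hlow : (1 - F N) * F k ≤ ∑ l ∈ Finset.range (N + 1), f l * F (k - l) := by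
    rw [← h.sum_range, Finset.sum_mul]
    exact Finset.sum_le_sum fun l _ =>
      mul_le_mul_of_nonneg_left (h.antitone (Nat.sub_le _ _)) (h.nonneg _)
  have := mul_lt_mul_of_pos_right (hN₀ N hN) (h.pos k)
  linarith

variable {y : ℕ → ℝ}

theorem sum_Ico_le_tsum_tail (hy : ∀ m, 0 ≤ y m) (hs : Summable y) (a b : ℕ) :
    ∑ m ∈ Finset.Ico a b, y m ≤ ∑' n, y (a + n) := by
  rw [Finset.sum_Ico_eq_sum_range]
  exact ((summable_nat_add_iff a).2 hs |>.congr fun n => by rw [add_comm]).sum_le_tsum _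
    fun n _ => hy _

/-- Summation by parts for the sum of `y m * F (K + N - 1 - m)`. -/
theorem SubexpTail.sum_mul_le (h : SubexpTail F f) (hy : ∀ m, 0 ≤ y m) (hs : Summable y)
    (K N : ℕ) :
    ∑ m ∈ Finset.range K, y m * F (K + N - 1 - m) ≤
      (∑' n, y (0 + n)) * F (K + N)
        + ∑ l ∈ Finset.Ioc N (K + N), f l * ∑' n, y (K + N - l + n) := by
  -- Expand `F (K + N - 1 - m)` into `F (K + N)` and the masses `f l` with `K + N - m ≤ l ≤ K + N`.
  -- Since `m < K`, all these `l` exceed `N`, so only the far part of `f` enters.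
  have h1 : ∀ m ∈ Finset.range K, y m * F (K + N - 1 - m) = y m * F (K + N)
      + ∑ l ∈ Finset.Ioc N (K + N), if K + N ≤ m + l then f l * y m else 0 := by
    intro m hm
    rw [Finset.mem_range] at hm
    have : (Finset.Ioc N (K + N)).filter (fun l => K + N ≤ m + l)
        = Finset.Ioc (K + N - 1 - m) (K + N) := by
      ext; simp; omega
    rw [← Finset.sum_filter, this, ← Finset.sum_mul, h.sum_Ioc (by omega)]
    ring
  rw [Finset.sum_congr rfl h1, Finset.sum_add_distrib, ← Finset.sum_mul, Finset.sum_comm]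
  refine add_le_add (mul_le_mul_of_nonneg_right ?_ (h.pos _).le)
    (Finset.sum_le_sum fun l hl => ?_)
  · rw [Finset.range_eq_Ico]
    exact sum_Ico_le_tsum_tail hy hs 0 K
  · rw [← Finset.sum_filter, ← Finset.mul_sum]
    refine mul_le_mul_of_nonneg_left ?_ (h.nonneg l)
    have : (Finset.range K).filter (fun m => K + N ≤ m + l) = Finset.Ico (K + N - l) K := by
      ext; simp; omega
    rw [this]
    exact sum_Ico_le_tsum_tail hy hs _ _

/-- If the tail of `y` is at most `G * F` before `K + N`, the sum of `y m * F (K + N - 1 - m)` over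
`m < K` exceeds the mass of `y` times `F (K + N)` by at most `ε * G * F (K + N)`. -/
theorem SubexpTail.exists_sum_mul_le (h : SubexpTail F f) {ε : ℝ} (hε : 0 < ε) :
    ∃ N₀, ∀ N ≥ N₀, ∀ᶠ K in atTop, ∀ y : ℕ → ℝ, (∀ m, 0 ≤ y m) → Summable y →
      ∀ G : ℝ, 0 ≤ G → (∀ n < K + N, ∑' i, y (n + i) ≤ G * F n) →
      ∑ m ∈ Finset.range K, y m * F (K + N - 1 - m) ≤
        ((∑' n, y (0 + n)) + ε * G) * F (K + N) := by
  -- The thresholds are fixed before `y` and `G` appear. This uniformity lets the estimate serve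
  -- inside an induction that bounds the tail of `y` itself.
  obtain ⟨N₀, hN₀⟩ := h.exists_sum_Ioc_le hε
  refine ⟨N₀, fun N hN => ?_⟩
  filter_upwards [(tendsto_add_atTop_nat N).eventually (hN₀ N hN)] with K hK y hy hs G hG hyG
  refine (h.sum_mul_le hy hs K N).trans ?_
  rw [add_mul]
  refine add_le_add le_rfl ?_
  calc ∑ l ∈ Finset.Ioc N (K + N), f l * ∑' n, y (K + N - l + n)
      ≤ ∑ l ∈ Finset.Ioc N (K + N), G * (f l * F (K + N - l)) := by
        refine Finset.sum_le_sum fun l hl => ?_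
        rw [Finset.mem_Ioc] at hl
        rw [mul_left_comm]
        exact mul_le_mul_of_nonneg_left (hyG _ (by omega)) (h.nonneg l)
    _ = G * ∑ l ∈ Finset.Ioc N (K + N), f l * F (K + N - l) := by rw [Finset.mul_sum]
    _ ≤ G * (ε * F (K + N)) := mul_le_mul_of_nonneg_left hK hG
    _ = _ := by ring

theorem tendsto_tsum_tail (y : ℕ → ℝ) :
    Tendsto (fun k => ∑' n, y (k + n)) atTop (𝓝 0) := by
  simpa only [add_comm] using tendsto_sum_nat_add y

theorem sum_range_eq_tsum_tail_sub (hs : Summable y) (K : ℕ) :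
    ∑ m ∈ Finset.range K, y m = (∑' n, y (0 + n)) - ∑' n, y (K + n) := by
  simp only [zero_add, ← hs.sum_add_tsum_nat_add K, add_comm K]
  ring

/-- The part of a convolution that comes from small values of the summand with law `y` and large
values of the summand with tail `t ∼ c F`. -/
theorem SubexpTail.exists_abs_sum_mul_sub_le (h : SubexpTail F f) (hy : ∀ m, 0 ≤ y m)
    (hs : Summable y) {G : ℝ} (hG : 0 ≤ G) (hyG : ∀ n, ∑' i, y (n + i) ≤ G * F n)
    {t : ℕ → ℝ} {c : ℝ} (ht : Tendsto (fun k => t k / F k) atTop (𝓝 c)) {ε : ℝ} (hε : 0 < ε) :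
    ∃ N₀, ∀ N ≥ N₀, ∀ᶠ K in atTop,
      |∑ m ∈ Finset.range K, y m * t (K + N - 1 - m) - c * (∑' n, y (0 + n)) * F (K + N)|
        ≤ ε * F (K + N) := by
  set H := ∑' n, y (0 + n) with hH
  have hH0 : 0 ≤ H := tsum_nonneg fun _ => hy _
  obtain ⟨δ, hδ, hδ1, hδε⟩ : ∃ δ > 0, δ ≤ 1 ∧ δ * (H + G + |c|) < ε := by
    refine ⟨min 1 (ε / (2 * (H + G + |c| + 1))), by positivity, min_le_left _ _, ?_⟩
    calc _ ≤ ε / (2 * (H + G + |c| + 1)) * (H + G + |c|) :=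
          mul_le_mul_of_nonneg_right (min_le_right _ _) (by positivity)
      _ < ε := by
        rw [div_mul_eq_mul_div, div_lt_iff₀ (by positivity)]
        nlinarith [abs_nonneg c]
  obtain ⟨δ', hδ', hδ1', hδG'⟩ : ∃ δ' > 0, δ' ≤ δ ∧ δ' * G ≤ δ := by
    refine ⟨δ / (G + 1), by positivity, div_le_self hδ.le (by linarith), ?_⟩
    rw [div_mul_eq_mul_div, div_le_iff₀ (by positivity)]
    nlinarith
  obtain ⟨N₁, hN₁⟩ := h.exists_sum_mul_le hδ'
  obtain ⟨N₂, hN₂⟩ := eventually_atTop.1 ((Metric.tendsto_nhds.1 ht) δ hδ)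
  refine ⟨max N₁ N₂, fun N hN => ?_⟩
  filter_upwards [hN₁ N (le_trans (le_max_left _ _) hN),
    (tendsto_tsum_tail y).eventually (gt_mem_nhds hδ)] with K hK hK'
  have hF := h.pos (K + N)
  have hup := hK y hy hs G hG fun n _ => hyG n
  have hlow : (H - δ) * F (K + N) ≤ ∑ m ∈ Finset.range K, y m * F (K + N - 1 - m) := by
    calc (H - δ) * F (K + N) ≤ (∑ m ∈ Finset.range K, y m) * F (K + N) := by
          rw [sum_range_eq_tsum_tail_sub hs]
          exact mul_le_mul_of_nonneg_right (by linarith) hF.le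
      _ ≤ _ := by
          rw [Finset.sum_mul]
          exact Finset.sum_le_sum fun m _ =>
            mul_le_mul_of_nonneg_left (h.antitone (by omega)) (hy m)
  set q := ∑ m ∈ Finset.range K, y m * F (K + N - 1 - m)
  have hq : |q - H * F (K + N)| ≤ δ * F (K + N) := by
    rw [abs_le]; constructor <;> nlinarith
  -- All arguments `K + N - 1 - m` are at least `N`, where `t` is within `δ F` of `c F`.
  have ht' : |∑ m ∈ Finset.range K, y m * t (K + N - 1 - m) - c * q| ≤ δ * q := by
    rw [Finset.mul_sum, Finset.mul_sum, ← Finset.sum_sub_distrib]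
    refine (Finset.abs_sum_le_sum_abs _ _).trans (Finset.sum_le_sum fun m hm => ?_)
    rw [Finset.mem_range] at hm
    have h1 := hN₂ (K + N - 1 - m) (le_trans (le_max_right N₁ _) (by omega))
    have hFm := h.pos (K + N - 1 - m)
    rw [Real.dist_eq, div_sub' hFm.ne', abs_div, abs_of_pos hFm, div_lt_iff₀ hFm] at h1
    rw [mul_left_comm c, ← mul_sub, abs_mul, abs_of_nonneg (hy m), mul_left_comm δ, mul_comm c]
    exact mul_le_mul_of_nonneg_left h1.le (hy m)
  have hqle : q ≤ (H + G) * F (K + N) :=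
    hup.trans (mul_le_mul_of_nonneg_right (by nlinarith) hF.le)
  calc _ = |(∑ m ∈ Finset.range K, y m * t (K + N - 1 - m) - c * q)
        + c * (q - H * F (K + N))| := by congr 1; ring
    _ ≤ δ * q + |c| * (δ * F (K + N)) := by
        refine (abs_add_le _ _).trans (add_le_add ht' ?_)
        rw [abs_mul]
        exact mul_le_mul_of_nonneg_left hq (abs_nonneg c)
    _ ≤ δ * ((H + G) * F (K + N)) + |c| * (δ * F (K + N)) := by gcongr
    _ = δ * (H + G + |c|) * F (K + N) := by ring
    _ ≤ _ := mul_le_mul_of_nonneg_right hδε.le hF.le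

end Tails

/-- The tail of a subexponential distribution is a subexponential tail. -/
theorem IsSubexponential.subexpTail {μ : Measure ℕ} [IsProbabilityMeasure μ]
    (h : IsSubexponential μ) : SubexpTail (fun k => μ.real {n | k < n}) (fun l => μ.real {l}) where
  pos := h.1
  zero := by
    have : {n : ℕ | 0 < n} = {0}ᶜ := by ext n; simp; omega
    rw [this, probReal_compl_eq_one_sub (by measurability)]; ring
  succ k := by
    have : {n : ℕ | k < n} = {k + 1} ∪ {n | k + 1 < n} := by ext n; simp; omega
    rw [this, measureReal_union (by simp) (by measurability)]; ring
  nonneg _ := measureReal_nonneg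
  tendsto_zero := by
    have := tendsto_measure_iInter_atTop (μ := μ) (s := fun k : ℕ => {n | k < n})
      (fun _ => (by measurability : MeasurableSet _).nullMeasurableSet)
      (fun a b hab n (hn : b < n) => lt_of_le_of_lt hab hn) ⟨0, measure_ne_top _ _⟩
    have he : (⋂ k : ℕ, {n : ℕ | k < n}) = ∅ := by
      ext n
      simpa using ⟨n, le_rfl⟩
    rw [he, measure_empty] at this
    exact (ENNReal.tendsto_toReal ENNReal.zero_ne_top).comp this
  conv := by
    -- Condition on the first summand: either it exceeds `k`, or it equals some `l ≤ k` and the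
    -- second exceeds `k - l`.
    have key : ∀ k : ℕ, (μ.prod μ).real {p | k < p.1 + p.2} = μ.real {n | k < n}
        + ∑ l ∈ Finset.range (k + 1), μ.real {l} * μ.real {n | k - l < n} := by
      intro k
      have hset : {p : ℕ × ℕ | k < p.1 + p.2} = ({n | k < n} ×ˢ Set.univ)
          ∪ ⋃ l ∈ Finset.range (k + 1), ({l} ×ˢ {n | k - l < n}) := by
        ext ⟨a, b⟩
        simp
        omega
      rw [hset, measureReal_union (h₁ := measure_ne_top _ _) (h₂ := measure_ne_top _ _),
        measureReal_prod_prod, measureReal_biUnion_finset]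
      · simp [measureReal_prod_prod]
      · intro a _ b _ hab
        simp only [Function.onFun, Set.disjoint_left]
        rintro ⟨u, v⟩ h1 h2
        simp at h1 h2
        exact hab (h1.1.symm.trans h2.1)
      · intro l _; measurability
      · rw [Set.disjoint_left]
        rintro ⟨u, v⟩ h1 h2
        simp at h1 h2
        omega
      · measurability
    have := h.2.sub_const 1
    rw [show (2 : ℝ) - 1 = 1 by norm_num] at this
    refine this.congr fun k => ?_
    rw [key, add_div, div_self (h.1 k).ne', add_sub_cancel_left]

/-! ### Irreducible nonnegative matrices -/

section Irreducible

theorem _root_.Matrix.IsIrreducible.forall_of_step {n : Type*} {A : Matrix n n ℝ}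
    (hA : A.IsIrreducible) {p : n → Prop} (step : ∀ i j, p i → 0 < A i j → p j) {i : n}
    (hi : p i) (j : n) : p j := by
  let := A.toQuiver
  obtain ⟨q, -⟩ := hA.connected i j
  induction q with
  | nil => exact hi
  | cons _ e ih => exact step _ _ ih e.down

variable {M : ℕ} {Q : Matrix (Fin M) (Fin M) ℝ}

/-- Minimum principle for irreducible strictly substochastic matrices. -/
theorem IsStrictlySubstochastic.nonneg_of_mulVec_le (hs : IsStrictlySubstochastic Q)
    (hQ : Q.IsIrreducible) {v : Fin M → ℝ} (hv : ∀ i, (Q *ᵥ v) i ≤ v i) (i : Fin M) : 0 ≤ v i := by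
  by_contra! hi
  have : Nonempty (Fin M) := ⟨i⟩
  obtain ⟨i₀, hmin⟩ := Finite.exists_min v
  have hm : v i₀ < 0 := (hmin i).trans_lt hi
  obtain ⟨hnn, hle, hne⟩ := hs
  have hrow (i) : ∑ j, Q i j ≤ 1 := by simpa [Matrix.mulVec, dotProduct] using hle i
  have hsum (i) : ∑ j, Q i j * (v j - v i₀) ≤ v i - v i₀ * ∑ j, Q i j := by
    have := hv i
    simp only [Matrix.mulVec, dotProduct] at this
    simp only [mul_sub, Finset.sum_sub_distrib, ← Finset.sum_mul]
    linarith
  have hterm (i j) : 0 ≤ Q i j * (v j - v i₀) := mul_nonneg (hnn i j) (sub_nonneg.2 (hmin j))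
  -- At a minimiser the right side of `hsum` is `v i₀ * (1 - row sum) ≤ 0`, so each `j` with `Q i j
  -- > 0` is a minimiser too. A constant negative `v` then forces every row sum to be 1.
  have hall : ∀ j, v j = v i₀ := by
    refine hQ.forall_of_step (p := fun j => v j = v i₀) (fun i j hij hpos => ?_) rfl
    have h1 := Finset.single_le_sum (fun j _ => hterm i j) (Finset.mem_univ j)
    have h2 : Q i j * (v j - v i₀) ≤ 0 := by
      refine h1.trans ((hsum i).trans ?_)
      rw [hij]
      nlinarith [hrow i]
    have h3 := nonpos_of_mul_nonpos_right h2 hpos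
    linarith [hmin j]
  apply hne
  ext i
  have h0 := (Finset.sum_nonneg fun j _ => hterm i j).trans (hsum i)
  rw [hall i] at h0
  have : ∑ j, Q i j = 1 := by nlinarith [hrow i]
  simpa [Matrix.mulVec, dotProduct] using this

theorem IsStrictlySubstochastic.isUnit_det (hs : IsStrictlySubstochastic Q)
    (hQ : Q.IsIrreducible) : IsUnit (1 - Q).det := by
  rw [← Matrix.isUnit_iff_isUnit_det, ← Matrix.mulVec_injective_iff_isUnit]
  refine (injective_iff_map_eq_zero (1 - Q).mulVecLin).2 fun v hv => ?_
  rw [Matrix.mulVecLin_apply, Matrix.sub_mulVec, Matrix.one_mulVec, sub_eq_zero] at hv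
  have h1 := hs.nonneg_of_mulVec_le hQ (v := v) fun i => by rw [← hv]
  have h2 := hs.nonneg_of_mulVec_le hQ (v := -v) fun i => by rw [Matrix.mulVec_neg, ← hv]
  ext i
  exact le_antisymm (by simpa using h2 i) (h1 i)

/-- `(I - Q)⁻¹` is positive for irreducible strictly substochastic `Q`. -/
theorem IsStrictlySubstochastic.inv_pos (hs : IsStrictlySubstochastic Q)
    (hQ : Q.IsIrreducible) (i j : Fin M) : 0 < (1 - Q)⁻¹ i j := by
  set R := (1 - Q)⁻¹
  have hR : ∀ i, R i j = (Q *ᵥ fun k => R k j) i + (1 : Matrix (Fin M) (Fin M) ℝ) i j := by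
    intro i
    have h1 := congr_fun (congr_fun (Matrix.mul_nonsing_inv _ (hs.isUnit_det hQ)) i) j
    rw [Matrix.sub_mul, Matrix.one_mul, Matrix.sub_apply] at h1
    rw [← h1]
    simp [Matrix.mul_apply, Matrix.mulVec, dotProduct, R]
  have hone (i) : 0 ≤ (1 : Matrix (Fin M) (Fin M) ℝ) i j := by
    rw [Matrix.one_apply]; split_ifs <;> norm_num
  have hnn : ∀ i, 0 ≤ R i j := hs.nonneg_of_mulVec_le hQ (v := fun k => R k j) fun i => by
    linarith [hR i, hone i]
  have hterm (i k) : 0 ≤ Q i k * R k j := mul_nonneg (hs.1 i k) (hnn k)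
  by_contra! hi
  -- A zero in column `j` spreads along the positive entries of `Q` and reaches the diagonal, where
  -- `hR` gives `R j j ≥ 1`.
  have hzero := hQ.forall_of_step (p := fun k => R k j = 0) (fun i k hi hpos => ?_)
    (le_antisymm hi (hnn i)) j
  · have h1 := hR j
    rw [hzero, Matrix.one_apply_eq] at h1
    have : 0 ≤ ∑ k, Q j k * R k j := Finset.sum_nonneg fun k _ => hterm j k
    simp only [Matrix.mulVec, dotProduct] at h1
    linarith
  · have h1 := Finset.single_le_sum (fun k _ => hterm i k) (Finset.mem_univ k)
    have h2 := hR i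
    simp only [Matrix.mulVec, dotProduct] at h2
    have h3 : Q i k * R k j ≤ 0 := by linarith [hone i]
    exact le_antisymm (nonpos_of_mul_nonpos_right h3 hpos) (hnn k)

/-- A stationary distribution of an irreducible matrix is positive. -/
theorem IsStationaryDistribution.pos {S : Type*} {T : Matrix S S ℝ} {x : S → ℝ}
    (hx : IsStationaryDistribution T x) (hT : T.IsIrreducible) (s : S) : 0 < x s := by
  obtain ⟨hnn, hsum, hst⟩ := hx
  obtain ⟨s₀, hs₀⟩ : ∃ s₀, 0 < x s₀ := by
    by_contra! h
    have : x = 0 := funext fun s => le_antisymm (h s) (hnn s)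
    rw [this] at hsum
    exact zero_ne_one (hasSum_zero.unique hsum)
  refine hT.forall_of_step (p := fun s => 0 < x s) (fun i j hi hij => ?_) hs₀ s
  exact (mul_pos hi hij).trans_le (le_hasSum (hst j) i fun k _ => mul_nonneg (hnn k) (hT.nonneg k j))

end Irreducible

/-! ### Tails of convolutions -/

section Convolution

/-- The tail `∑_{l ≥ z} a l` of a function on `ℤ`. -/
noncomputable def intTail (a : ℤ → ℝ) (z : ℤ) : ℝ := ∑' n : ℕ, a (z + n)

variable {a : ℤ → ℝ} {y : ℕ → ℝ}

theorem intTail_eq_tsum_indicator (a : ℤ → ℝ) (z : ℤ) :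
    intTail a z = ∑' l, (Set.Ici z).indicator a l := by
  have hinj : Function.Injective fun n : ℕ => z + (n : ℤ) := fun m n h => by simpa using h
  rw [← hinj.tsum_eq (f := (Set.Ici z).indicator a)]
  · simp [intTail]
  · intro l hl
    have hl' : z ≤ l := by
      by_contra h
      exact hl (Set.indicator_of_notMem (s := Set.Ici z) h a)
    exact ⟨(l - z).toNat, by simp; omega⟩

theorem intTail_nonneg (ha : ∀ l, 0 ≤ a l) (z : ℤ) : 0 ≤ intTail a z :=
  tsum_nonneg fun _ => ha _

theorem intTail_antitone (ha : ∀ l, 0 ≤ a l) (hs : Summable a) : Antitone (intTail a) := by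
  intro z w hzw
  rw [intTail_eq_tsum_indicator, intTail_eq_tsum_indicator]
  exact (hs.indicator _).tsum_le_tsum (fun l =>
    Set.indicator_le_indicator_of_subset (Set.Ici_subset_Ici.2 hzw) ha l) (hs.indicator _)

theorem intTail_le_tsum (ha : ∀ l, 0 ≤ a l) (hs : Summable a) (z : ℤ) :
    intTail a z ≤ ∑' l, a l := by
  rw [intTail_eq_tsum_indicator]
  exact (hs.indicator _).tsum_le_tsum (fun l => Set.indicator_le_self' (fun _ _ => ha _) l) hs

theorem tendsto_intTail_neg (hs : Summable a) :
    Tendsto (fun N : ℕ => intTail a (-N)) atTop (𝓝 (∑' l, a l)) := by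
  simp only [intTail_eq_tsum_indicator]
  refine tendsto_tsum_of_dominated_convergence hs.norm (fun l => ?_)
    (Eventually.of_forall fun N l => norm_indicator_le_norm_self a l)
  refine tendsto_const_nhds.congr' ?_
  filter_upwards [eventually_ge_atTop l.natAbs] with N hN
  rw [Set.indicator_of_mem]
  simp only [Set.mem_Ici]
  omega

theorem summable_mul_intTail (ha : ∀ l, 0 ≤ a l) (hs : Summable a) (hy : ∀ m, 0 ≤ y m)
    (hys : Summable y) (k : ℕ) : Summable fun m : ℕ => y m * intTail a (k - m) :=
  .of_nonneg_of_le (fun m => mul_nonneg (hy m) (intTail_nonneg ha _))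
    (fun m => mul_le_mul_of_nonneg_left (intTail_le_tsum ha hs _) (hy m))
    (hys.mul_right (∑' l, a l))

theorem summable_uncurry_mul (ha : ∀ l, 0 ≤ a l) (hs : Summable a) (hy : ∀ m, 0 ≤ y m)
    (hys : Summable y) (k : ℕ) :
    Summable (Function.uncurry fun (m n : ℕ) => y m * a (((k + n : ℕ) : ℤ) - m)) := by
  have hinj (m : ℕ) : Function.Injective fun n : ℕ => ((k + n : ℕ) : ℤ) - m :=
    fun n n' h => by simpa using h
  refine (summable_prod_of_nonneg fun p => mul_nonneg (hy _) (ha _)).2 ⟨fun m => ?_, ?_⟩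
  · exact (hs.comp_injective (hinj m)).mul_left (y m)
  · refine (summable_mul_intTail ha hs hy hys k).congr fun m => ?_
    simp only [tsum_mul_left, intTail]
    congr 2
    ext n
    congr 1
    push_cast
    ring_nf

theorem tsum_tsum_mul_eq (ha : ∀ l, 0 ≤ a l) (hs : Summable a) (hy : ∀ m, 0 ≤ y m)
    (hys : Summable y) (k : ℕ) :
    ∑' (n : ℕ) (m : ℕ), y m * a (((k + n : ℕ) : ℤ) - m) = ∑' m : ℕ, y m * intTail a (k - m) := by
  rw [(summable_uncurry_mul ha hs hy hys k).tsum_comm]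
  simp only [tsum_mul_left, intTail]
  congr! 5
  push_cast
  ring_nf

theorem tsum_mul_intTail_le (ha : ∀ l, 0 ≤ a l) (hs : Summable a) (hy : ∀ m, 0 ≤ y m)
    (hys : Summable y) (K N : ℕ) :
    ∑' m : ℕ, y m * intTail a ((K + N : ℕ) - m) ≤
      ∑ m ∈ Finset.range K, y m * intTail a ((K + N : ℕ) - m)
        + (∑' n, y (K + n)) * ∑' l, a l := by
  have hsum := summable_mul_intTail ha hs hy hys (K + N)
  rw [← hsum.sum_add_tsum_nat_add K, ← tsum_mul_right]
  refine add_le_add le_rfl ?_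
  refine ((summable_nat_add_iff K).2 hsum).tsum_le_tsum (fun n => ?_) ?_
  · rw [add_comm n K]
    exact mul_le_mul_of_nonneg_left (intTail_le_tsum ha hs _) (hy _)
  · exact (((summable_nat_add_iff K).2 hys).congr fun n => by rw [add_comm]).mul_right _

/-- For `m ≥ K + 2N` the argument `K + N - m` is at most `-N`, so the factor is at least `intTail a
(-N)`, nearly the full mass of `a` for large `N`. The terms with `K ≤ m < K + 2N` are dropped. -/
theorem le_tsum_mul_intTail (ha : ∀ l, 0 ≤ a l) (hs : Summable a) (hy : ∀ m, 0 ≤ y m)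
    (hys : Summable y) (K N : ℕ) :
    ∑ m ∈ Finset.range K, y m * intTail a ((K + N : ℕ) - m)
        + (∑' n, y (K + N + N + n)) * intTail a (-N) ≤
      ∑' m : ℕ, y m * intTail a ((K + N : ℕ) - m) := by
  have hsum := summable_mul_intTail ha hs hy hys (K + N)
  rw [← hsum.sum_add_tsum_nat_add (K + N + N), ← tsum_mul_right]
  refine add_le_add ?_ ?_
  · exact Finset.sum_le_sum_of_subset_of_nonneg (Finset.range_subset_range.2 (by omega))
      fun m _ _ => mul_nonneg (hy m) (intTail_nonneg ha _)
  · refine Summable.tsum_le_tsum (fun n => ?_) ?_ ((summable_nat_add_iff _).2 hsum)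
    · rw [add_comm n]
      exact mul_le_mul_of_nonneg_left (intTail_antitone ha hs (by push_cast; omega)) (hy _)
    · exact (((summable_nat_add_iff (K + N + N)).2 hys).congr fun n => by
        rw [add_comm]).mul_right _

end Convolution

/-! ### The stationary equations -/

namespace Blocks

variable {M₀ M : ℕ} {D : Blocks M₀ M}

theorem A_nonneg (hT : IsStochastic D.T) (i j : Fin M) (z : ℤ) : 0 ≤ D.A z i j := by
  -- `A z` is the block from level `|z| + 1` to level `z + |z| + 1`, both positive.
  have := hT.1 (Sum.inr ((z.natAbs + 1).toPNat', i))
    (Sum.inr ((z + (z.natAbs + 1 : ℕ)).toNat.toPNat', j))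
  simp only [T] at this
  convert this using 2
  simp only [Nat.toPNat'_coe]
  split_ifs <;> omega

theorem summable_A (hT : IsStochastic D.T) (i j : Fin M) : Summable fun z : ℤ => D.A z i j := by
  classical
  refine summable_of_sum_le (c := 1) (fun z => A_nonneg hT i j z) fun u => ?_
  -- From level `k` every jump in `u` lands on a positive level, so the finite sum is part of a
  -- single row of `T`.
  set k := u.sup Int.natAbs + 1 with hk
  have hu : ∀ z ∈ u, 0 < z + k := fun z hz => by
    have := Finset.le_sup (f := Int.natAbs) hz
    omega
  set g : ℤ → State M₀ M := fun z => Sum.inr ((z + k).toNat.toPNat', j) with hg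
  have hinj : Set.InjOn g u := by
    intro z hz w hw h
    simp only [hg, Sum.inr.injEq, Prod.mk.injEq, and_true] at h
    have h1 := congr_arg (fun n : ℕ+ => (n : ℕ)) h
    have := hu z hz
    have := hu w hw
    simp only [Nat.toPNat'_coe] at h1
    split_ifs at h1 <;> omega
  calc ∑ z ∈ u, D.A z i j = ∑ z ∈ u, D.T (Sum.inr (k.toPNat', i)) (g z) := by
        refine Finset.sum_congr rfl fun z hz => ?_
        have := hu z hz
        simp only [hg, T]
        congr 1
        simp only [Nat.toPNat'_coe]
        split_ifs <;> omega
    _ = ∑ s ∈ u.image g, D.T (Sum.inr (k.toPNat', i)) s := (Finset.sum_image hinj).symm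
    _ ≤ 1 := sum_le_hasSum _ (fun s _ => hT.1 _ s) (hT.2 _)

theorem injective_inr_succPNat (M₀ : ℕ) (i : Fin M) :
    Function.Injective fun m : ℕ => (Sum.inr (m.succPNat, i) : State M₀ M) := fun m n h => by
  simpa using h

theorem summable_Bpos (hT : IsStochastic D.T) (i : Fin M₀) (j : Fin M) :
    Summable fun n : ℕ => D.Bpos n.succPNat i j :=
  (hT.2 (Sum.inl i)).summable.comp_injective (injective_inr_succPNat M₀ j)

theorem Atail_eq_intTail (k : ℕ) (i j : Fin M) :
    D.Atail k i j = intTail (fun z => D.A z i j) ((k : ℤ) + 1) := by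
  simp only [Atail, intTail, Matrix.of_apply]
  exact tsum_congr fun n => by rw [add_right_comm]

end Blocks

open Blocks

variable {M₀ M : ℕ} {D : Blocks M₀ M} {x : State M₀ M → ℝ}

theorem IsStationaryDistribution.apply_inr (hx : IsStationaryDistribution D.T x) (l : ℕ)
    (j : Fin M) :
    x (Sum.inr (l.succPNat, j)) = ∑ i, x (Sum.inl i) * D.Bpos l.succPNat i j
      + ∑ i, ∑' m : ℕ, x (Sum.inr (m.succPNat, i)) * D.A ((l : ℤ) - m) i j := by
  have h := hx.2.2 (Sum.inr (l.succPNat, j))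
  have hr := h.summable.comp_injective Sum.inr_injective
  let e : Fin M × ℕ ≃ ℕ+ × Fin M :=
    (Equiv.prodComm _ _).trans (Equiv.prodCongr Equiv.pnatEquivNat.symm (Equiv.refl _))
  have hr' := (e.summable_iff).2 hr
  rw [← h.tsum_eq, Summable.tsum_sum (h.summable.comp_injective Sum.inl_injective) hr,
    tsum_fintype, ← e.tsum_eq]
  congr 1
  refine (hr'.tsum_prod).trans ?_
  rw [tsum_fintype]
  refine Finset.sum_congr rfl fun i _ => tsum_congr fun m => ?_
  change x (Sum.inr (m.succPNat, i)) * D.A (((l.succPNat : ℕ) : ℤ) - ((m.succPNat : ℕ) : ℤ)) i j = _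
  simp

theorem IsStationaryDistribution.summable_level (hx : IsStationaryDistribution D.T x)
    (i : Fin M) : Summable fun m : ℕ => x (Sum.inr (m.succPNat, i)) :=
  hx.2.1.summable.comp_injective (injective_inr_succPNat M₀ i)

/-- Index `m` stands for level `m + 1`, so passing from it to a level above `k` takes a jump of at
least `k - m`. -/
theorem IsStationaryDistribution.levelTail_eq (hT : IsStochastic D.T)
    (hx : IsStationaryDistribution D.T x) (k : ℕ) (j : Fin M) :
    levelTail x k j = (levelZero x ᵥ* D.Btail k) j
      + ∑ i, ∑' m : ℕ, x (Sum.inr (m.succPNat, i)) * intTail (fun z => D.A z i j) (k - m) := by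
  have hB (i : Fin M₀) :
      Summable fun n : ℕ => x (Sum.inl i) * D.Bpos (k + n).succPNat i j :=
    (((summable_nat_add_iff k).2 (summable_Bpos hT i j)).congr fun n => by
      rw [add_comm]).mul_left _
  have hA (i : Fin M) : Summable fun n : ℕ => ∑' m : ℕ,
      x (Sum.inr (m.succPNat, i)) * D.A (((k + n : ℕ) : ℤ) - m) i j :=
    (summable_uncurry_mul (A_nonneg hT i j) (summable_A hT i j) (fun _ => hx.1 _)
      (hx.summable_level i) k).prod_symm.prod
  rw [levelTail, tsum_congr fun n => hx.apply_inr (k + n) j,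
    Summable.tsum_add (summable_sum fun i _ => hB i) (summable_sum fun i _ => hA i),
    Summable.tsum_finsetSum fun i _ => hB i, Summable.tsum_finsetSum fun i _ => hA i]
  congr 1
  · simp [Matrix.vecMul, dotProduct, levelZero, Btail, tsum_mul_left]
  · exact Finset.sum_congr rfl fun i _ => tsum_tsum_mul_eq (A_nonneg hT i j) (summable_A hT i j)
      (fun _ => hx.1 _) (hx.summable_level i) k

/-! ### Tail asymptotics for matrix renewal equations -/

section Renewal

variable {F f : ℕ → ℝ}

theorem SubexpTail.exists_le_mul (h : SubexpTail F f) {t : ℕ → ℝ} {c : ℝ}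
    (ht : Tendsto (fun k => t k / F k) atTop (𝓝 c)) : ∃ C, 0 ≤ C ∧ ∀ k, t k ≤ C * F k := by
  obtain ⟨C, hC⟩ := ht.bddAbove_range
  refine ⟨max C 0, le_max_right _ _, fun k => ?_⟩
  rw [← div_le_iff₀ (h.pos k)]
  exact (hC ⟨k, rfl⟩).trans (le_max_left _ _)

theorem vecMul_apply_eq_sum {m n : ℕ} (w : Fin m → ℝ) (A : Matrix (Fin m) (Fin n) ℝ) (j : Fin n) :
    (w ᵥ* A) j = ∑ i, w i * A i j := rfl

theorem le_of_forall_pos_le_add_mul {a b c : ℝ} (h : ∀ ε > 0, a ≤ b + ε * c) : a ≤ b := by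
  have : Tendsto (fun ε : ℝ => b + ε * c) (𝓝[>] 0) (𝓝 (b + 0 * c)) :=
    (by fun_prop : Continuous fun ε : ℝ => b + ε * c).continuousAt.mono_left nhdsWithin_le_nhds
  rw [zero_mul, add_zero] at this
  exact ge_of_tendsto this (eventually_mem_nhdsWithin.mono fun ε hε => h ε hε)

theorem tsum_tail_le {y : ℕ → ℝ} (hy : ∀ m, 0 ≤ y m) (hs : Summable y) (k : ℕ) :
    ∑' n, y (k + n) ≤ ∑' n, y (0 + n) := by
  simp only [zero_add]
  exact tsum_comp_le_tsum_of_inj hs hy (add_right_injective k)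

/-- The data of a matrix renewal equation `h j k = b j k + ∑ i, ∑ m, y i m * (tail of a i j)`
for the tails `h i k = ∑ n, y i (k + n)`. -/
structure RenewalData (M : ℕ) where
  y : Fin M → ℕ → ℝ
  a : Fin M → Fin M → ℤ → ℝ
  b : Fin M → ℕ → ℝ
  y_nonneg : ∀ i m, 0 ≤ y i m
  y_summable : ∀ i, Summable (y i)
  a_nonneg : ∀ i j z, 0 ≤ a i j z
  a_summable : ∀ i j, Summable (a i j)
  eq : ∀ j (k : ℕ), ∑' n, y j (k + n)
    = b j k + ∑ i, ∑' m : ℕ, y i m * intTail (a i j) (k - m)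

namespace RenewalData

variable {M : ℕ} (R : RenewalData M)

/-- The tails of the unknown. -/
noncomputable def h (i : Fin M) (k : ℕ) : ℝ := ∑' n, R.y i (k + n)

/-- The matrix of total masses of the kernel. -/
noncomputable def Q : Matrix (Fin M) (Fin M) ℝ := Matrix.of fun i j => ∑' z, R.a i j z

/-- The tails of the kernel. -/
noncomputable def t (i j : Fin M) (k : ℕ) : ℝ := intTail (R.a i j) ((k : ℤ) + 1)

theorem h_nonneg (i : Fin M) (k : ℕ) : 0 ≤ R.h i k := tsum_nonneg fun _ => R.y_nonneg i _

theorem sum_range_eq (i j : Fin M) (K N : ℕ) :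
    ∑ m ∈ Finset.range K, R.y i m * intTail (R.a i j) ((K + N : ℕ) - m)
      = ∑ m ∈ Finset.range K, R.y i m * R.t i j (K + N - 1 - m) := by
  refine Finset.sum_congr rfl fun m hm => ?_
  rw [Finset.mem_range] at hm
  rw [t]
  congr 2
  omega

theorem h_le (j : Fin M) (K N : ℕ) :
    R.h j (K + N) ≤ R.b j (K + N)
      + ∑ i, (∑ m ∈ Finset.range K, R.y i m * R.t i j (K + N - 1 - m) + R.h i K * R.Q i j) := by
  rw [h, R.eq]
  refine add_le_add le_rfl (Finset.sum_le_sum fun i _ => ?_)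
  rw [← sum_range_eq]
  exact tsum_mul_intTail_le (R.a_nonneg i j) (R.a_summable i j) (R.y_nonneg i) (R.y_summable i) K N

theorem le_h (j : Fin M) (K N : ℕ) :
    R.b j (K + N) + ∑ i, (∑ m ∈ Finset.range K, R.y i m * R.t i j (K + N - 1 - m)
      + R.h i (K + N + N) * intTail (R.a i j) (-N)) ≤ R.h j (K + N) := by
  rw [h, R.eq]
  refine add_le_add le_rfl (Finset.sum_le_sum fun i _ => ?_)
  rw [← sum_range_eq]
  exact le_tsum_mul_intTail (R.a_nonneg i j) (R.a_summable i j) (R.y_nonneg i) (R.y_summable i) K N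

variable {R} {β : Fin M → ℝ} {c : Matrix (Fin M) (Fin M) ℝ}

/-- Strong induction on `k` for the weighted bound `h i k ≤ G p i F k`, where `p Q = p - 1`. The
gain of 1 in each component absorbs the errors of order `ε G` and the terms not involving `G`. -/
theorem exists_h_le (hF : SubexpTail F f) (hQ : R.Q.IsIrreducible)
    (hs : IsStrictlySubstochastic R.Q)
    (hb : ∀ j, Tendsto (fun k => R.b j k / F k) atTop (𝓝 (β j)))
    (ht : ∀ i j, Tendsto (fun k => R.t i j k / F k) atTop (𝓝 (c i j))) :
    ∃ G, 0 ≤ G ∧ ∀ i k, R.h i k ≤ G * F k := by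
  set p : Fin M → ℝ := 1 ᵥ* (1 - R.Q)⁻¹ with hp
  have hp_eq (j) : ∑ i, p i * R.Q i j = p j - 1 := by
    have h1 : p ᵥ* (1 - R.Q) = 1 := by
      rw [hp, Matrix.vecMul_vecMul, Matrix.nonsing_inv_mul _ (hs.isUnit_det hQ), Matrix.vecMul_one]
    have h2 := congr_fun h1 j
    rw [Matrix.vecMul_sub, Matrix.vecMul_one] at h2
    simp only [Pi.sub_apply, Pi.one_apply, Matrix.vecMul, dotProduct] at h2
    linarith
  have hp0 (j) : 0 ≤ p j := by
    rw [hp, vecMul_apply_eq_sum]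
    exact Finset.sum_nonneg fun i _ => by simpa using (hs.inv_pos hQ i j).le
  have hp1 (j) : 1 ≤ p j := by
    have : 0 ≤ ∑ i, p i * R.Q i j := Finset.sum_nonneg fun i _ => mul_nonneg (hp0 i) (hs.1 i j)
    linarith [hp_eq j]
  choose Cb hCb0 hCb using fun j => hF.exists_le_mul (hb j)
  choose Ct hCt0 hCt using fun i j => hF.exists_le_mul (ht i j)
  set B := ∑ j, Cb j
  set C := ∑ i, ∑ j, Ct i j
  set P := ∑ i, p i
  set H := ∑ i, R.h i 0
  have hB0 : 0 ≤ B := Finset.sum_nonneg fun j _ => hCb0 j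
  have hC0 : 0 ≤ C := Finset.sum_nonneg fun i _ => Finset.sum_nonneg fun j _ => hCt0 i j
  have hP0 : 0 ≤ P := Finset.sum_nonneg fun j _ => hp0 j
  have hH0 : 0 ≤ H := Finset.sum_nonneg fun j _ => R.h_nonneg j 0
  have hbB (j k) : R.b j k ≤ B * F k := (hCb j k).trans <|
    mul_le_mul_of_nonneg_right (Finset.single_le_sum (fun j _ => hCb0 j) (Finset.mem_univ j))
      (hF.pos k).le
  have htC (i j k) : R.t i j k ≤ C * F k := (hCt i j k).trans <|
    mul_le_mul_of_nonneg_right ((Finset.single_le_sum (fun j _ => hCt0 i j)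
      (Finset.mem_univ j)).trans (Finset.single_le_sum (f := fun i => ∑ j, Ct i j)
        (fun i _ => Finset.sum_nonneg fun j _ => hCt0 i j) (Finset.mem_univ i))) (hF.pos k).le
  obtain ⟨ε, hε, hεP⟩ : ∃ ε > 0, ε * (P + C * P) ≤ 1 / 2 := by
    refine ⟨1 / (2 * (P + C * P + 1)), by positivity, ?_⟩
    rw [div_mul_eq_mul_div, div_le_div_iff₀ (by positivity) (by positivity)]
    nlinarith
  obtain ⟨N₀, hN₀⟩ := hF.exists_sum_mul_le hε
  -- `N ≥ 1` makes `K < K + N`, so the induction hypothesis applies at `K`.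
  set N := N₀ + 1
  obtain ⟨K₀, hK₀⟩ := eventually_atTop.1 ((hN₀ N (by omega)).and
    ((hF.tendsto_div_add N).eventually (gt_mem_nhds (show (1 : ℝ) < 1 + ε by linarith))))
  -- The first summand closes the induction step, where half of the gain 1 survives; the second
  -- covers all `k < K₀ + N`.
  set G := 2 * (B + C * H) + H / F (K₀ + N)
  have hFK := hF.pos (K₀ + N)
  have hG0 : 0 ≤ G := by positivity
  have key : ∀ k i, R.h i k ≤ G * p i * F k := by
    intro k
    induction k using Nat.strong_induction_on with
    | _ k ih =>
      intro j
      rcases lt_or_ge k (K₀ + N) with hk | hk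
      · calc R.h j k ≤ R.h j 0 := tsum_tail_le (R.y_nonneg j) (R.y_summable j) k
          _ ≤ H := Finset.single_le_sum (fun i _ => R.h_nonneg i 0) (Finset.mem_univ j)
          _ = H / F (K₀ + N) * 1 * F (K₀ + N) := by field_simp
          _ ≤ G * p j * F k := by
            have h1 : H / F (K₀ + N) ≤ G := le_add_of_nonneg_left (by positivity)
            have h2 := hF.antitone hk.le
            have h3 := hp1 j
            gcongr
      · obtain ⟨K, rfl⟩ : ∃ K, k = K + N := ⟨k - N, by omega⟩
        obtain ⟨hsub, hlong⟩ := hK₀ K (by omega)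
        have hFk := hF.pos (K + N)
        rw [div_lt_iff₀ hFk] at hlong
        have hterm (i) : ∑ m ∈ Finset.range K, R.y i m * R.t i j (K + N - 1 - m)
            + R.h i K * R.Q i j ≤
            (C * R.h i 0 + G * (C * ε * p i) + G * ((1 + ε) * (p i * R.Q i j))) * F (K + N) := by
          have h1 : ∑ m ∈ Finset.range K, R.y i m * R.t i j (K + N - 1 - m)
              ≤ C * ∑ m ∈ Finset.range K, R.y i m * F (K + N - 1 - m) := by
            rw [Finset.mul_sum]
            refine Finset.sum_le_sum fun m _ => ?_
            rw [mul_left_comm]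
            exact mul_le_mul_of_nonneg_left (htC i j _) (R.y_nonneg i m)
          have h2 := hsub (R.y i) (R.y_nonneg i) (R.y_summable i) (G * p i)
            (mul_nonneg hG0 (hp0 i)) fun n hn => ih n hn i
          have h3 : R.h i K ≤ G * p i * ((1 + ε) * F (K + N)) :=
            (ih K (by omega) i).trans
              (mul_le_mul_of_nonneg_left hlong.le (mul_nonneg hG0 (hp0 i)))
          calc _ ≤ C * ((R.h i 0 + ε * (G * p i)) * F (K + N))
                + G * p i * ((1 + ε) * F (K + N)) * R.Q i j :=
                add_le_add (h1.trans (mul_le_mul_of_nonneg_left h2 hC0))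
                  (mul_le_mul_of_nonneg_right h3 (hs.1 i j))
            _ = _ := by ring
        calc R.h j (K + N) ≤ B * F (K + N) + ∑ i, (C * R.h i 0 + G * (C * ε * p i)
              + G * ((1 + ε) * (p i * R.Q i j))) * F (K + N) :=
              (R.h_le j K N).trans (add_le_add (hbB _ _) (Finset.sum_le_sum fun i _ => hterm i))
          _ = (B + C * H + G * (C * ε * P + (1 + ε) * (p j - 1))) * F (K + N) := by
              rw [← Finset.sum_mul, Finset.sum_add_distrib, Finset.sum_add_distrib,
                ← Finset.mul_sum, ← Finset.mul_sum, ← Finset.mul_sum, ← Finset.mul_sum,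
                ← Finset.mul_sum, hp_eq]
              ring
          _ ≤ G * p j * F (K + N) := by
              refine mul_le_mul_of_nonneg_right ?_ hFk.le
              have h1 : p j ≤ P := Finset.single_le_sum (fun i _ => hp0 i) (Finset.mem_univ j)
              have h2 : C * ε * P + (1 + ε) * (p j - 1) ≤ p j - 1 / 2 := by nlinarith
              have h3 : 2 * (B + C * H) ≤ G := le_add_of_nonneg_right (by positivity)
              nlinarith [mul_le_mul_of_nonneg_left h2 hG0]
  refine ⟨G * P, by positivity, fun i k => (key k i).trans ?_⟩
  exact mul_le_mul_of_nonneg_right (mul_le_mul_of_nonneg_left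
    (Finset.single_le_sum (fun i _ => hp0 i) (Finset.mem_univ i)) hG0) (hF.pos k).le

/-- One `N` must serve both bounds: large enough for the single-big-jump estimate and for `intTail
(R.a i j) (-N)` to be close to `R.Q i j`. The a priori bound turns the latter error into a multiple
of `F (K + N)`. -/
theorem eventually_h_le_and_le_h (hF : SubexpTail F f)
    (hb : ∀ j, Tendsto (fun k => R.b j k / F k) atTop (𝓝 (β j)))
    (ht : ∀ i j, Tendsto (fun k => R.t i j k / F k) atTop (𝓝 (c i j)))
    {G : ℝ} (hG0 : 0 ≤ G) (hG : ∀ i k, R.h i k ≤ G * F k) (j : Fin M) {ε : ℝ} (hε : 0 < ε) :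
    ∃ N, ∀ᶠ K in atTop,
      R.h j (K + N) ≤ (β j + ∑ i, R.h i 0 * c i j + ε) * F (K + N) + ∑ i, R.h i K * R.Q i j ∧
      (β j + ∑ i, R.h i 0 * c i j - ε) * F (K + N) + ∑ i, R.h i (K + N + N) * R.Q i j
        ≤ R.h j (K + N) := by
  obtain ⟨δ, hδ, hδε⟩ : ∃ δ > 0, δ + M * (δ + δ * G) = ε := by
    refine ⟨ε / (1 + M * (1 + G)), by positivity, ?_⟩
    field_simp
  have h1 : ∀ i, ∀ᶠ N in atTop, ∀ᶠ K in atTop,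
      |∑ m ∈ Finset.range K, R.y i m * R.t i j (K + N - 1 - m) - c i j * R.h i 0 * F (K + N)|
        ≤ δ * F (K + N) := fun i => eventually_atTop.2 <|
    hF.exists_abs_sum_mul_sub_le (R.y_nonneg i) (R.y_summable i) hG0 (hG i) (ht i j) hδ
  have h2 : ∀ i, ∀ᶠ N : ℕ in atTop, R.Q i j - δ < intTail (R.a i j) (-N) := fun i =>
    (tendsto_intTail_neg (R.a_summable i j)).eventually (lt_mem_nhds (sub_lt_self _ hδ))
  obtain ⟨N, hN1, hN2⟩ := ((eventually_all.2 h1).and (eventually_all.2 h2)).exists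
  refine ⟨N, ?_⟩
  filter_upwards [eventually_all.2 hN1, (tendsto_add_atTop_nat N).eventually
    ((Metric.tendsto_nhds.1 (hb j)) δ hδ)] with K hK hKb
  have hFk := hF.pos (K + N)
  rw [Real.dist_eq, div_sub' hFk.ne', abs_div, abs_of_pos hFk, div_lt_iff₀ hFk, abs_lt] at hKb
  have hsum : ∑ i : Fin M, (δ + δ * G) = M * (δ + δ * G) := by
    rw [Finset.sum_const, Finset.card_univ, Fintype.card_fin, nsmul_eq_mul]
  constructor
  · calc R.h j (K + N) ≤ R.b j (K + N) + ∑ i, (∑ m ∈ Finset.range K, R.y i m *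
          R.t i j (K + N - 1 - m) + R.h i K * R.Q i j) := R.h_le j K N
      _ ≤ (β j + δ) * F (K + N)
          + ∑ i, ((R.h i 0 * c i j + (δ + δ * G)) * F (K + N) + R.h i K * R.Q i j) := by
        refine add_le_add (by linarith) (Finset.sum_le_sum fun i _ => add_le_add ?_ le_rfl)
        have := (abs_le.1 (hK i)).2
        have : 0 ≤ δ * G * F (K + N) := by positivity
        linarith
      _ = _ := by
        rw [Finset.sum_add_distrib, ← Finset.sum_mul, Finset.sum_add_distrib, hsum, ← hδε]
        ring
  · calc _ = (β j - δ) * F (K + N) + ∑ i, ((R.h i 0 * c i j - (δ + δ * G)) * F (K + N)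
          + R.h i (K + N + N) * R.Q i j) := by
          rw [Finset.sum_add_distrib, ← Finset.sum_mul, Finset.sum_sub_distrib, hsum, ← hδε]
          ring
      _ ≤ R.b j (K + N) + ∑ i, (∑ m ∈ Finset.range K, R.y i m * R.t i j (K + N - 1 - m)
          + R.h i (K + N + N) * intTail (R.a i j) (-N)) := by
        refine add_le_add (by linarith) (Finset.sum_le_sum fun i _ => ?_)
        have h3 := (abs_le.1 (hK i)).1
        have h4 := mul_le_mul_of_nonneg_left (hN2 i).le (R.h_nonneg i (K + N + N))
        have h5 : R.h i (K + N + N) ≤ G * F (K + N) := (hG i _).trans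
          (mul_le_mul_of_nonneg_left (hF.antitone (by omega)) hG0)
        have h6 := mul_le_mul_of_nonneg_left h5 hδ.le
        linarith
      _ ≤ _ := R.le_h j K N

/-- Solutions of matrix renewal equations with subexponential data have tails proportional to the
subexponential tail. -/
theorem tendsto_h_div (hF : SubexpTail F f) (hQ : R.Q.IsIrreducible)
    (hs : IsStrictlySubstochastic R.Q)
    (hb : ∀ j, Tendsto (fun k => R.b j k / F k) atTop (𝓝 (β j)))
    (ht : ∀ i j, Tendsto (fun k => R.t i j k / F k) atTop (𝓝 (c i j))) (j : Fin M) :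
    Tendsto (fun k => R.h j k / F k) atTop
      (𝓝 (((β + (fun i => R.h i 0) ᵥ* c) ᵥ* (1 - R.Q)⁻¹) j)) := by
  obtain ⟨G, hG0, hG⟩ := exists_h_le hF hQ hs hb ht
  set v : Fin M → ℝ := β + (fun i => R.h i 0) ᵥ* c with hv
  have hvj (j) : v j = β j + ∑ i, R.h i 0 * c i j := rfl
  set s : Fin M → ℕ → ℝ := fun i k => R.h i k / F k with hsdef
  have hs0 (i k) : 0 ≤ s i k := div_nonneg (R.h_nonneg i k) (hF.pos k).le
  have hsG (i k) : s i k ≤ G := (div_le_iff₀ (hF.pos k)).2 (hG i k)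
  have hsF (i k) : R.h i k = s i k * F k := (div_mul_cancel₀ _ (hF.pos k).ne').symm
  have hbd (i) : IsBoundedUnder (· ≤ ·) atTop (s i) := isBoundedUnder_of ⟨G, hsG i⟩
  have hbd' (i) : IsBoundedUnder (· ≥ ·) atTop (s i) := isBoundedUnder_of ⟨0, hs0 i⟩
  set u : Fin M → ℝ := fun i => limsup (s i) atTop
  set l : Fin M → ℝ := fun i => liminf (s i) atTop
  have hlu (i) : l i ≤ u i := liminf_le_limsup (hbd i) (hbd' i)
  have hratio (N : ℕ) := hF.tendsto_div_add N
  -- Long-tailedness replaces `F K` by `F (K + N)` at the cost of a second `ε`, hence the slack `2 *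
  -- ε` per term.
  have hu (j) : u j ≤ v j + ∑ i, u i * R.Q i j := by
    refine le_of_forall_pos_le_add_mul (c := 1 + 2 * ∑ i, R.Q i j) fun ε hε => ?_
    obtain ⟨N, hN⟩ := eventually_h_le_and_le_h hF hb ht hG0 hG j hε
    have h1 : ∀ i, ∀ᶠ K in atTop, R.h i K ≤ (u i + 2 * ε) * F (K + N) := fun i => by
      have h2 : Tendsto (fun K => (u i + ε) * (F K / F (K + N))) atTop (𝓝 (u i + ε)) := by
        simpa using (hratio N).const_mul (u i + ε)
      filter_upwards [eventually_lt_of_limsup_lt (show limsup (s i) atTop < u i + ε by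
        exact lt_add_of_pos_right _ hε) (hbd i), h2.eventually (gt_mem_nhds
          (show u i + ε < u i + 2 * ε by linarith))] with K hK hK2
      rw [← mul_div_assoc, div_lt_iff₀ (hF.pos _)] at hK2
      rw [hsF]
      exact (mul_le_mul_of_nonneg_right hK.le (hF.pos K).le).trans hK2.le
    refine limsup_le_of_le ((hbd' j).isCoboundedUnder_le) ?_
    rw [← map_add_atTop_eq_nat N, eventually_map]
    filter_upwards [hN, eventually_all.2 h1] with K hK hK1
    rw [hsdef, div_le_iff₀ (hF.pos _)]
    refine hK.1.trans ?_
    calc _ ≤ (v j + ε) * F (K + N) + ∑ i, (u i + 2 * ε) * F (K + N) * R.Q i j :=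
          add_le_add le_rfl (Finset.sum_le_sum fun i _ =>
            mul_le_mul_of_nonneg_right (hK1 i) (hs.1 i j))
      _ = (v j + ε) * F (K + N) + ∑ i, (u i * R.Q i j + 2 * ε * R.Q i j) * F (K + N) := by
          congr 1
          exact Finset.sum_congr rfl fun i _ => by ring
      _ = _ := by
          rw [← Finset.sum_mul, Finset.sum_add_distrib, ← Finset.mul_sum]
          ring
  -- The mirror image, with `F (K + N + N)` compared to `F (K + N)`.
  have hl (j) : v j + ∑ i, l i * R.Q i j ≤ l j := by
    refine le_of_forall_pos_le_add_mul (c := 1 + 2 * ∑ i, R.Q i j) fun ε hε => ?_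
    obtain ⟨N, hN⟩ := eventually_h_le_and_le_h hF hb ht hG0 hG j hε
    have h1 : ∀ i, ∀ᶠ K in atTop, (l i - 2 * ε) * F (K + N) ≤ R.h i (K + N + N) := fun i => by
      have h2 : Tendsto (fun K => (l i - ε) * (F (K + N) / F (K + N + N))⁻¹) atTop
          (𝓝 (l i - ε)) := by
        simpa using (((hratio N).comp (tendsto_add_atTop_nat N)).inv₀ one_ne_zero).const_mul
          (l i - ε)
      have h3 := (tendsto_add_atTop_nat (N + N)).eventually
        (eventually_lt_of_lt_liminf (show l i - ε < liminf (s i) atTop by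
          exact sub_lt_self _ hε) (hbd' i))
      filter_upwards [h3, h2.eventually (lt_mem_nhds
          (show l i - 2 * ε < l i - ε by linarith))] with K hK hK2
      rw [inv_div, ← mul_div_assoc, lt_div_iff₀ (hF.pos _)] at hK2
      rw [hsF]
      rw [← add_assoc] at hK
      exact hK2.le.trans (mul_le_mul_of_nonneg_right hK.le (hF.pos _).le)
    rw [← sub_le_iff_le_add]
    refine le_liminf_of_le ((hbd j).isCoboundedUnder_ge) ?_
    rw [← map_add_atTop_eq_nat N, eventually_map]
    filter_upwards [hN, eventually_all.2 h1] with K hK hK1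
    rw [hsdef, le_div_iff₀ (hF.pos _)]
    refine le_trans ?_ hK.2
    calc _ = (v j - ε) * F (K + N) + ∑ i, (l i * R.Q i j - 2 * ε * R.Q i j) * F (K + N) := by
          rw [← Finset.sum_mul, Finset.sum_sub_distrib, ← Finset.mul_sum]
          ring
      _ = (v j - ε) * F (K + N) + ∑ i, (l i - 2 * ε) * F (K + N) * R.Q i j := by
          congr 1
          exact Finset.sum_congr rfl fun i _ => by ring
      _ ≤ _ := add_le_add le_rfl (Finset.sum_le_sum fun i _ =>
            mul_le_mul_of_nonneg_right (hK1 i) (hs.1 i j))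
  have hinv (w : Fin M → ℝ) : (w ᵥ* (1 - R.Q)) ᵥ* (1 - R.Q)⁻¹ = w := by
    rw [Matrix.vecMul_vecMul, Matrix.mul_nonsing_inv _ (hs.isUnit_det hQ), Matrix.vecMul_one]
  have hmul (w : Fin M → ℝ) (i) : (w ᵥ* (1 - R.Q)) i = w i - ∑ k, w k * R.Q k i := by
    rw [Matrix.vecMul_sub, Matrix.vecMul_one]
    rfl
  -- Subtracting the two inequalities gives `(u - l) (I - Q) ≤ 0`; multiplying by the nonnegative
  -- inverse preserves the sign.
  have hul : u = l := by
    refine le_antisymm ?_ hlu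
    intro i
    have h1 : ((u - l) ᵥ* (1 - R.Q)) ᵥ* (1 - R.Q)⁻¹ = u - l := hinv _
    have h2 : (u - l) i ≤ 0 := by
      rw [← h1, vecMul_apply_eq_sum]
      refine Finset.sum_nonpos fun k _ => mul_nonpos_of_nonpos_of_nonneg ?_ (hs.inv_pos hQ k i).le
      rw [hmul]
      simp only [Pi.sub_apply, sub_mul, Finset.sum_sub_distrib]
      linarith [hu k, hl k]
    exact sub_nonpos.1 h2
  have hueq : u = v ᵥ* (1 - R.Q)⁻¹ := by
    rw [← hinv u]
    congr 1
    ext i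
    rw [hmul]
    have := hl i
    rw [← hul] at this
    linarith [hu i]
  rw [← hueq]
  exact tendsto_of_liminf_eq_limsup (congr_fun hul j).symm rfl (hbd j) (hbd' j)

end RenewalData

end Renewal

/-- The renewal equation satisfied by the stationary distribution of a chain of GI/G/1 type. -/
noncomputable def renewalData {M₀ M : ℕ} {D : Blocks M₀ M} {x : State M₀ M → ℝ}
    (hT : IsStochastic D.T) (hx : IsStationaryDistribution D.T x) : RenewalData M where
  y i m := x (Sum.inr (m.succPNat, i))
  a i j z := D.A z i j
  b j k := (levelZero x ᵥ* D.Btail k) j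
  y_nonneg _ _ := hx.1 _
  y_summable := hx.summable_level
  a_nonneg := D.A_nonneg hT
  a_summable := D.summable_A hT
  eq j k := hx.levelTail_eq hT k j

end GIG1

/-! ### Tail asymptotics of the stationary distribution -/

theorem theorem3p2 {M₀ M : ℕ} (D : GIG1.Blocks M₀ M)
    (hT_stoch : GIG1.IsStochastic D.T)
    (hT_irr : D.T.IsIrreducible)
    (hT_rec : GIG1.IsPositiveRecurrent D.T)
    (hA_irr : D.Asum.IsIrreducible)
    (hA_sub : GIG1.IsStrictlySubstochastic D.Asum)
    (x : GIG1.State M₀ M → ℝ) (hx : GIG1.IsStationaryDistribution D.T x)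
    {Ω : Type*} [MeasurableSpace Ω] (P : Measure Ω) [IsProbabilityMeasure P]
    (Y : Ω → ℕ) (hY : Measurable Y)
    (C_A : Matrix (Fin M) (Fin M) ℝ) (C_B : Matrix (Fin M₀) (Fin M) ℝ)
    (hC_A : ∀ i j, 0 ≤ C_A i j) (hC_B : ∀ i j, 0 ≤ C_B i j)
    (hC : C_A ≠ 0 ∨ C_B ≠ 0)
    (hA_tail : ∀ i j, Tendsto (fun k : ℕ => D.Atail k i j / P.real {ω | k < Y ω})
      atTop (𝓝 (C_A i j)))
    (hB_tail : ∀ i j, Tendsto (fun k : ℕ => D.Btail k i j / P.real {ω | k < Y ω})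
      atTop (𝓝 (C_B i j)))
    (hY_sub : GIG1.IsSubexponential (P.map Y)) :
    IsUnit (1 - D.Asum).det ∧
      ∀ j, Tendsto (fun k : ℕ => GIG1.levelTail x k j / P.real {ω | k < Y ω}) atTop
          (𝓝 (((GIG1.levelZero x ᵥ* C_B + GIG1.levelTail x 0 ᵥ* C_A) ᵥ* (1 - D.Asum)⁻¹) j)) ∧
        0 < ((GIG1.levelZero x ᵥ* C_B + GIG1.levelTail x 0 ᵥ* C_A) ᵥ* (1 - D.Asum)⁻¹) j := by
  have : IsProbabilityMeasure (P.map Y) := Measure.isProbabilityMeasure_map hY.aemeasurable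
  have hF := hY_sub.subexpTail
  have hmap (k : ℕ) : (P.map Y).real {n | k < n} = P.real {ω | k < Y ω} :=
    map_measureReal_apply hY (by measurability)
  simp only [hmap] at hF
  refine ⟨hA_sub.isUnit_det hA_irr, fun j => ⟨?_, ?_⟩⟩
  · refine GIG1.RenewalData.tendsto_h_div (R := GIG1.renewalData hT_stoch hx) hF hA_irr hA_sub
      (fun j => ?_) (fun i j => ?_) j
    · have := tendsto_finsetSum Finset.univ fun i _ =>
        (hB_tail i j).const_mul (GIG1.levelZero x i)
      refine this.congr fun k => ?_
      simp only [GIG1.renewalData, Matrix.vecMul, dotProduct, Finset.sum_div, mul_div_assoc]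
    · refine (hA_tail i j).congr fun k => ?_
      rw [GIG1.Blocks.Atail_eq_intTail]
      rfl
  · have hpos := hx.pos hT_irr
    have hx0 (i) : 0 < GIG1.levelZero x i := hpos _
    have hx1 (i) : 0 < GIG1.levelTail x 0 i := by
      have hs : Summable fun n : ℕ => x (Sum.inr ((0 + n).succPNat, i)) := by
        simpa only [zero_add] using hx.summable_level i
      exact hs.tsum_pos (fun n => (hpos _).le) 0 (hpos _)
    have hB0 (k) : 0 ≤ (GIG1.levelZero x ᵥ* C_B) k := by
      rw [GIG1.vecMul_apply_eq_sum]
      exact Finset.sum_nonneg fun i _ => mul_nonneg (hx0 i).le (hC_B i k)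
    have hA0 (k) : 0 ≤ (GIG1.levelTail x 0 ᵥ* C_A) k := by
      rw [GIG1.vecMul_apply_eq_sum]
      exact Finset.sum_nonneg fun i _ => mul_nonneg (hx1 i).le (hC_A i k)
    -- One positive component suffices, because every entry of `(I - A)⁻¹` is positive.
    obtain ⟨k, hk⟩ : ∃ k, 0 < (GIG1.levelZero x ᵥ* C_B + GIG1.levelTail x 0 ᵥ* C_A) k := by
      rcases hC with hC | hC
      · obtain ⟨i, k, hik⟩ : ∃ i k, C_A i k ≠ 0 := by
          by_contra! h
          exact hC (Matrix.ext h)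
        refine ⟨k, add_pos_of_nonneg_of_pos (hB0 k) ?_⟩
        exact Finset.sum_pos' (fun i _ => mul_nonneg (hx1 i).le (hC_A i k))
          ⟨i, Finset.mem_univ i, mul_pos (hx1 i) ((hC_A i k).lt_of_ne' hik)⟩
      · obtain ⟨i, k, hik⟩ : ∃ i k, C_B i k ≠ 0 := by
          by_contra! h
          exact hC (Matrix.ext h)
        refine ⟨k, add_pos_of_pos_of_nonneg ?_ (hA0 k)⟩
        exact Finset.sum_pos' (fun i _ => mul_nonneg (hx0 i).le (hC_B i k))
          ⟨i, Finset.mem_univ i, mul_pos (hx0 i) ((hC_B i k).lt_of_ne' hik)⟩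
    exact Finset.sum_pos' (fun i _ => mul_nonneg (add_nonneg (hB0 i) (hA0 i))
      (hA_sub.inv_pos hA_irr i j).le)
      ⟨k, Finset.mem_univ k, mul_pos hk (hA_sub.inv_pos hA_irr k j)⟩
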